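/- Let $\alpha=(\alpha_n)_{n\ge 1}$ be a positive, strictly increasing sequence of real numbers with $\alpha_n\to\infty$, and let $(s_k)_{k\ge1}\subset(1,\infty)$ be strictly increasing with $s_k\to\infty$. Put $v_k(n):=s_k^{-\alpha_n}$ and let $c_0(v_k)$ be the Banach space of all complex sequences $x=(x_n)$ with $v_k(n)x_n\to0$, normed by $\sup_n v_k(n)|x_n|$. Let $E_\alpha:=\operatorname{ind}_k c_0(v_k)$, i.e. $E_\alpha=\bigcup_k c_0(v_k)$ with the finest locally convex topology for which all inclusions $c_0(v_k)\hookrightarrow E_\alpha$ are continuous (as a locally convex space, $E_\alpha$ does not depend on the choice of $(s_k)$). Let $\mathsf C$ be the Cesàro operator $\mathsf C x=\bigl(\tfrac{x_1+\dots+x_n}{n}\bigr)_{n\ge1}$, which is a continuous linear operator on $E_\alpha$, and let $\sigma_{pt}(\mathsf C;E_\alpha)$ be its point spectrum, the set of all $\lambda\in\mathbb C$ for which $\lambda I-\mathsf C$ is not injective on $E_\alpha$. Then the following assertions are equivalent: (i) $E_\alpha$ is nuclear; (ii) $\sup_{n\in\mathbb N}\frac{\log n}{\alpha_n}<\infty$;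 (iii) $\sigma_{pt}(\mathsf C;E_\alpha)=\{\tfrac1n:n\in\mathbb N\}$; (iv) $\sigma_{pt}(\mathsf C;E_\alpha)\setminus\{1\}\neq\emptyset$. -/

import Mathlib

open Filter Topology

noncomputable section

namespace CoEchelon

/-! ## Weighted Banach spaces of null sequences

Sequences `(x_1, x_2, …)` are written as functions `ℕ → ℂ` with `x n` standing for `x_{n+1}`. -/

/-- The sequences `x` with `v_n x_n → 0`, as a subspace of `ℂ^ℕ`. -/
def c0Sub (v : ℕ → ℝ) : Submodule ℂ (ℕ → ℂ) where
  carrier := {x | Tendsto (fun n => v n • x n) atTop (𝓝 0)}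
  add_mem' := fun {x y} hx hy => by
    have h := Tendsto.add (show Tendsto (fun n => v n • x n) atTop (𝓝 0) from hx)
      (show Tendsto (fun n => v n • y n) atTop (𝓝 0) from hy)
    show Tendsto (fun n => v n • (x + y) n) atTop (𝓝 0)
    simpa only [Pi.add_apply, smul_add, add_zero] using h
  zero_mem' := by simp
  smul_mem' := fun c x hx => by
    have h := Tendsto.const_smul (show Tendsto (fun n => v n • x n) atTop (𝓝 0) from hx) c
    show Tendsto (fun n => v n • (c • x) n) atTop (𝓝 0)
    simpa only [Pi.smul_apply, smul_comm _ c, smul_zero] using h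

theorem bddAbove_c0 {v : ℕ → ℝ} (x : c0Sub v) :
    BddAbove (Set.range fun n => ‖v n • (x : ℕ → ℂ) n‖) := by
  have h : Tendsto (fun n => v n • (x : ℕ → ℂ) n) atTop (𝓝 0) := x.2
  exact h.norm.bddAbove_range

/-- The norm `q(x) = sup_n |v_n x_n|` on `c_0(v)`. -/
def c0Norm (v : ℕ → ℝ) : Seminorm ℂ (c0Sub v) where
  toFun x := ⨆ n, ‖v n • (x : ℕ → ℂ) n‖
  map_zero' := by simp
  add_le' x y := by
    refine ciSup_le fun n => ?_
    have h : v n • ((x + y : c0Sub v) : ℕ → ℂ) n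
        = v n • (x : ℕ → ℂ) n + v n • (y : ℕ → ℂ) n := by
      simp [smul_add]
    rw [h]
    exact (norm_add_le _ _).trans
      (add_le_add (le_ciSup (bddAbove_c0 x) n) (le_ciSup (bddAbove_c0 y) n))
  neg' x := by simp
  smul' c x := by
    rw [Real.mul_iSup_of_nonneg (norm_nonneg c)]
    refine iSup_congr fun n => ?_
    simp [mul_left_comm]

/-- The weighted space `c_0(v)`, carrying the norm `q(x) = sup_n |v_n x_n|` (and not the
topology of coordinatewise convergence). -/
def C0 (v : ℕ → ℝ) : Type := c0Sub v

instance (v : ℕ → ℝ) : AddCommGroup (C0 v) := inferInstanceAs (AddCommGroup (c0Sub v))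

instance (v : ℕ → ℝ) : Module ℂ (C0 v) := inferInstanceAs (Module ℂ (c0Sub v))

instance (v : ℕ → ℝ) : SeminormedAddCommGroup (C0 v) :=
  AddGroupSeminorm.toSeminormedAddCommGroup
    (show Seminorm ℂ (C0 v) from c0Norm v).toAddGroupSeminorm

/-! ## Locally convex inductive limits -/

/-- The finest locally convex vector space topology on `F` for which all maps `j i : X i → F`
are continuous. -/
@[reducible] def inductiveTopology (F : Type*) [AddCommGroup F] [Module ℂ F] {ι : Type*}
    {X : ι → Type*} [∀ i, TopologicalSpace (X i)] (j : ∀ i, X i → F) : TopologicalSpace F :=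
  sInf {t : TopologicalSpace F | (∀ i, Continuous[_, t] (j i)) ∧ @IsTopologicalAddGroup F t _ ∧
    @ContinuousSMul ℂ F _ _ t ∧ @LocallyConvexSpace ℝ F _ _ _ _ t}

/-! ## The co-echelon space `E_α` -/

/-- The weights `v_k(n) = s_k ^ (-α_n)`. -/
def weight (α s : ℕ → ℝ) (k n : ℕ) : ℝ := s k ^ (-α n)

/-- The vector space `⋃_k c_0(v_k)` underlying `E_α`, written as the span of the union; see
`mem_coSub`. -/
def coSub (α s : ℕ → ℝ) : Submodule ℂ (ℕ → ℂ) := ⨆ k, c0Sub (weight α s k)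

/-- The space `E_α = ind_k c_0(v_k)`; its topology is the inductive limit topology given below. -/
def CoSpace (α s : ℕ → ℝ) : Type := coSub α s

instance (α s : ℕ → ℝ) : AddCommGroup (CoSpace α s) := inferInstanceAs (AddCommGroup (coSub α s))

instance (α s : ℕ → ℝ) : Module ℂ (CoSpace α s) := inferInstanceAs (Module ℂ (coSub α s))

/-- The inclusion `E_α ⊆ ℂ^ℕ`. -/
def CoSpace.toSeq {α s : ℕ → ℝ} : CoSpace α s →ₗ[ℂ] (ℕ → ℂ) := (coSub α s).subtype

/-- The inclusion `c_0(v_k) ⊆ E_α`. -/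
def CoSpace.incl (α s : ℕ → ℝ) (k : ℕ) : C0 (weight α s k) →ₗ[ℂ] CoSpace α s :=
  Submodule.inclusion (le_iSup (fun k => c0Sub (weight α s k)) k)

instance (α s : ℕ → ℝ) : TopologicalSpace (CoSpace α s) :=
  inductiveTopology (CoSpace α s) fun k => CoSpace.incl α s k

instance (α s : ℕ → ℝ) : IsTopologicalAddGroup (CoSpace α s) :=
  topologicalAddGroup_sInf fun _ h => h.2.1

instance (α s : ℕ → ℝ) : ContinuousSMul ℂ (CoSpace α s) :=
  continuousSMul_sInf fun _ h => h.2.2.1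

instance (α s : ℕ → ℝ) : LocallyConvexSpace ℝ (CoSpace α s) :=
  .sInf fun _ h => h.2.2.2

theorem CoSpace.continuous_incl (α s : ℕ → ℝ) (k : ℕ) : Continuous (CoSpace.incl α s k) :=
  continuous_sInf_rng.2 fun _ h => h.1 k

/-- `α_n ↑ ∞`: a positive, strictly increasing sequence tending to infinity. -/
structure IsExponent (α : ℕ → ℝ) : Prop where
  pos : ∀ n, 0 < α n
  strictMono : StrictMono α
  tendsto : Tendsto α atTop atTop

/-- A strictly increasing sequence in `(1, ∞)` tending to infinity. -/
structure IsBase (s : ℕ → ℝ) : Prop where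
  one_lt : ∀ k, 1 < s k
  strictMono : StrictMono s
  tendsto : Tendsto s atTop atTop

theorem weight_pos {α s : ℕ → ℝ} (hs : IsBase s) (k n : ℕ) : 0 < weight α s k n :=
  Real.rpow_pos_of_pos (zero_lt_one.trans (hs.one_lt k)) _

theorem weight_antitone {α s : ℕ → ℝ} (hα : IsExponent α) (hs : IsBase s) (k : ℕ) :
    Antitone (weight α s k) := fun _ _ hmn =>
  Real.rpow_le_rpow_of_exponent_le (hs.one_lt k).le (neg_le_neg (hα.strictMono.monotone hmn))

theorem weight_le {α s : ℕ → ℝ} (hα : IsExponent α) (hs : IsBase s) {k l : ℕ} (hkl : k ≤ l)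
    (n : ℕ) : weight α s l n ≤ weight α s k n :=
  Real.rpow_le_rpow_of_nonpos (zero_lt_one.trans (hs.one_lt k))
    (hs.strictMono.monotone hkl) (neg_nonpos.2 (hα.pos n).le)

theorem mem_c0Sub {v : ℕ → ℝ} (hv : ∀ n, 0 ≤ v n) (x : ℕ → ℂ) :
    x ∈ c0Sub v ↔ Tendsto (fun n => v n * ‖x n‖) atTop (𝓝 0) := by
  change Tendsto (fun n => v n • x n) atTop (𝓝 0) ↔ _
  rw [tendsto_zero_iff_norm_tendsto_zero]
  simp only [norm_smul, Real.norm_eq_abs, abs_of_nonneg (hv _)]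

/-- `E_α` is the union of the spaces `c_0(v_k)`. -/
theorem mem_coSub {α s : ℕ → ℝ} (hα : IsExponent α) (hs : IsBase s) (x : ℕ → ℂ) :
    x ∈ coSub α s ↔ ∃ k, Tendsto (fun n => weight α s k n * ‖x n‖) atTop (𝓝 0) := by
  have hmono : Monotone fun k => c0Sub (weight α s k) := by
    intro k l hkl y hy
    rw [mem_c0Sub fun n => (weight_pos hs _ n).le] at hy ⊢
    exact squeeze_zero (fun n => mul_nonneg (weight_pos hs l n).le (norm_nonneg _))
      (fun n => mul_le_mul_of_nonneg_right (weight_le hα hs hkl n) (norm_nonneg _)) hy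
  rw [coSub, Submodule.mem_iSup_of_directed _ hmono.directed_le]
  exact exists_congr fun k => mem_c0Sub (fun n => (weight_pos hs k n).le) x

/-! ## The Cesàro operator -/

/-- The Cesàro operator on `ℂ^ℕ`: `(x_1, x_2, …) ↦ (x_1, (x_1 + x_2) / 2, …)`. -/
def cesaroSeq : (ℕ → ℂ) →ₗ[ℂ] (ℕ → ℂ) where
  toFun x n := (∑ i ∈ Finset.range (n + 1), x i) / ((n : ℂ) + 1)
  map_add' x y := by
    funext n
    simp [Finset.sum_add_distrib, add_div]
  map_smul' c x := by
    funext n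
    simp [← Finset.mul_sum, mul_div_assoc]

theorem norm_cesaroSeq_le {v : ℕ → ℝ} (hv : ∀ n, 0 ≤ v n) (hm : Antitone v) (x : ℕ → ℂ) (n : ℕ) :
    v n * ‖cesaroSeq x n‖ ≤ ((n + 1 : ℕ) : ℝ)⁻¹ * ∑ i ∈ Finset.range (n + 1), v i * ‖x i‖ := by
  have h1 : ‖cesaroSeq x n‖ = ((n + 1 : ℕ) : ℝ)⁻¹ * ‖∑ i ∈ Finset.range (n + 1), x i‖ := by
    have h2 : cesaroSeq x n = (∑ i ∈ Finset.range (n + 1), x i) / ((n + 1 : ℕ) : ℂ) := by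
      simp [cesaroSeq]
    rw [h2, norm_div, Complex.norm_natCast, div_eq_inv_mul]
  rw [h1, mul_left_comm]
  refine mul_le_mul_of_nonneg_left ?_ (by positivity)
  refine (mul_le_mul_of_nonneg_left (norm_sum_le _ _) (hv n)).trans ?_
  rw [Finset.mul_sum]
  exact Finset.sum_le_sum fun i hi => mul_le_mul_of_nonneg_right
    (hm (Nat.lt_succ_iff.1 (Finset.mem_range.1 hi))) (norm_nonneg _)

theorem cesaroSeq_mem_c0 {v : ℕ → ℝ} (hv : ∀ n, 0 ≤ v n) (hm : Antitone v) {x : ℕ → ℂ}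
    (hx : x ∈ c0Sub v) : cesaroSeq x ∈ c0Sub v := by
  rw [mem_c0Sub hv] at hx ⊢
  exact squeeze_zero (fun n => mul_nonneg (hv n) (norm_nonneg _)) (norm_cesaroSeq_le hv hm x)
    (hx.cesaro.comp (tendsto_add_atTop_nat 1))

theorem c0Norm_cesaroSeq_le {v : ℕ → ℝ} (hv : ∀ n, 0 ≤ v n) (hm : Antitone v) (x : c0Sub v) :
    c0Norm v ⟨cesaroSeq x, cesaroSeq_mem_c0 hv hm x.2⟩ ≤ c0Norm v x := by
  refine ciSup_le fun n => ?_
  have hx : ∀ i, v i * ‖(x : ℕ → ℂ) i‖ ≤ c0Norm v x := fun i => by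
    have h : ‖v i • (x : ℕ → ℂ) i‖ ≤ c0Norm v x := le_ciSup (bddAbove_c0 x) i
    simpa only [norm_smul, Real.norm_eq_abs, abs_of_nonneg (hv i)] using h
  rw [norm_smul, Real.norm_eq_abs, abs_of_nonneg (hv n)]
  refine (norm_cesaroSeq_le hv hm x n).trans ?_
  rw [inv_mul_le_iff₀ (by positivity)]
  refine (Finset.sum_le_card_nsmul _ _ _ fun i _ => hx i).trans ?_
  simp [nsmul_eq_mul]

theorem continuous_cesaroC0 {v : ℕ → ℝ} (hv : ∀ n, 0 ≤ v n) (hm : Antitone v) :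
    Continuous (show C0 v → C0 v from
      fun x => ⟨cesaroSeq x.1, cesaroSeq_mem_c0 hv hm x.2⟩) := by
  let L : C0 v →ₗ[ℂ] C0 v :=
    LinearMap.restrict (p := c0Sub v) (q := c0Sub v) cesaroSeq
      fun _ hx => cesaroSeq_mem_c0 hv hm hx
  exact AddMonoidHomClass.continuous_of_bound L 1 fun x => by
    rw [one_mul]
    exact c0Norm_cesaroSeq_le hv hm x

theorem cesaroSeq_mem_coSub {α s : ℕ → ℝ} (hα : IsExponent α) (hs : IsBase s) :
    ∀ x ∈ coSub α s, cesaroSeq x ∈ coSub α s := by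
  change coSub α s ≤ (coSub α s).comap cesaroSeq
  refine iSup_le fun k x hx => ?_
  exact le_iSup (fun k => c0Sub (weight α s k)) k
    (cesaroSeq_mem_c0 (fun n => (weight_pos hs k n).le) (weight_antitone hα hs k) hx)

/-- The Cesàro operator as a linear map on `E_α`. -/
def cesaroLin {α s : ℕ → ℝ} (hα : IsExponent α) (hs : IsBase s) : CoSpace α s →ₗ[ℂ] CoSpace α s :=
  LinearMap.restrict cesaroSeq (cesaroSeq_mem_coSub hα hs)

theorem continuous_cesaroLin {α s : ℕ → ℝ} (hα : IsExponent α) (hs : IsBase s) :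
    Continuous (cesaroLin hα hs) := by
  rw [continuous_iff_le_induced]
  refine sInf_le ⟨fun k => ?_, topologicalAddGroup_induced _, continuousSMul_induced _,
    LocallyConvexSpace.induced ((cesaroLin hα hs).restrictScalars ℝ)⟩
  rw [continuous_induced_rng]
  exact (CoSpace.continuous_incl α s k).comp
    (continuous_cesaroC0 (fun n => (weight_pos hs k n).le) (weight_antitone hα hs k))

/-- The Cesàro operator `C ∈ L(E_α)`. -/
def cesaro {α s : ℕ → ℝ} (hα : IsExponent α) (hs : IsBase s) : CoSpace α s →L[ℂ] CoSpace α s :=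
  ⟨cesaroLin hα hs, continuous_cesaroLin hα hs⟩

@[simp] theorem toSeq_cesaro {α s : ℕ → ℝ} (hα : IsExponent α) (hs : IsBase s)
    (x : CoSpace α s) : (cesaro hα hs x).toSeq = cesaroSeq x.toSeq := rfl

/-! ## Point spectrum and nuclearity -/

/-- The point spectrum of `T ∈ L(E)`: all `z ∈ ℂ` for which `z I - T` is not injective. -/
def pointSpectrum {E : Type*} [AddCommGroup E] [Module ℂ E] [TopologicalSpace E]
    (T : E →L[ℂ] E) : Set ℂ :=
  {z | ¬ Function.Injective fun x : E => z • x - T x}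

/-- A bounded operator between Banach spaces is nuclear if `T x = ∑ f_i(x) y_i` with
`f_i` in the dual space and `∑ ‖f_i‖ ‖y_i‖ < ∞`. -/
def IsNuclearMap {X Y : Type*} [NormedAddCommGroup X] [NormedSpace ℂ X] [NormedAddCommGroup Y]
    [NormedSpace ℂ Y] (T : X →L[ℂ] Y) : Prop :=
  ∃ (f : ℕ → X →L[ℂ] ℂ) (y : ℕ → Y), (Summable fun i => ‖f i‖ * ‖y i‖) ∧
    ∀ x, HasSum (fun i => f i x • y i) (T x)

/-- `E` with the topology of the single seminorm `p`. -/
def LocalSpace {E : Type*} [AddCommGroup E] [Module ℂ E] (_p : Seminorm ℂ E) : Type _ := E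

instance {E : Type*} [AddCommGroup E] [Module ℂ E] (p : Seminorm ℂ E) :
    SeminormedAddCommGroup (LocalSpace p) :=
  AddGroupSeminorm.toSeminormedAddCommGroup (E := E) p.toAddGroupSeminorm

instance {E : Type*} [AddCommGroup E] [i : Module ℂ E] (p : Seminorm ℂ E) :
    Module ℂ (LocalSpace p) := i

instance {E : Type*} [AddCommGroup E] [Module ℂ E] (p : Seminorm ℂ E) :
    NormedSpace ℂ (LocalSpace p) where
  norm_smul_le c x := (map_smul_eq_mul p c (show E from x)).le

/-- The identity of `E` as a continuous map `(E, q) → (E, p)` for `p ≤ q`. -/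
def localId {E : Type*} [AddCommGroup E] [Module ℂ E] {p q : Seminorm ℂ E} (h : p ≤ q) :
    LocalSpace q →L[ℂ] LocalSpace p :=
  LinearMap.mkContinuous (LinearMap.id (R := ℂ) (M := E)) 1 fun x => by
    rw [one_mul]
    exact h x

/-- A locally convex space `E` is nuclear if every continuous seminorm `p` is dominated by a
continuous seminorm `q` such that the canonical map from the Banach space `E_q` to the Banach
space `E_p` is nuclear. Here `E_p` is the Hausdorff completion of `(E, p)`. -/
def IsNuclearSpace (E : Type*) [AddCommGroup E] [Module ℂ E] [TopologicalSpace E] : Prop :=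
  ∀ p : Seminorm ℂ E, Continuous p → ∃ (q : Seminorm ℂ E) (h : p ≤ q), Continuous q ∧
    IsNuclearMap (localId h).completion

end CoEchelon

end

open Filter Topology

noncomputable section

namespace CoEchelon

variable {α s : ℕ → ℝ}

/-! ## Functionals and nuclear maps on completions -/

/-! Everything is measured against `log (n + 1) = O(α n)`, which says exactly that polynomial
factors are absorbed by passing to a larger `s_k`.

Growth implies nuclearity: for a continuous seminorm `p`, the numbers `(n + 1) ^ 2 * p(e_n)` remain
dominated by every `v_k`, so they define a continuous weighted sup-seminorm. Adding it to `p` gives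
`q`, and the expansion `x = ∑ x_n e_n` is then a nuclear representation of `E_q → E_p`
(`isNuclearMap_localId`).

Nuclearity implies growth: a trace-like estimate shows that every positive weight `w` dominated by
all `v_k` is summable (`IsNuclearSpace.exists_sum_le`). If `log (n + 1) / α n` were unbounded, its
running maximum would produce a decreasing dominated `w` with `w_N = (N + 1) ^ (-1/2)` for
arbitrarily large `N`, which is not summable.

Spectrum: an eigenvector whose first nonzero entry is at `m` has eigenvalue `1 / (m + 1)`. The
binomials `n.choose m` realise it and grow polynomially, so growth puts them all in `E_α`.
Conversely, for `m ≥ 1` an eigenvector grows at least linearly, and its membership in some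
`c_0(v_k)` bounds `log (n + 1)` by a multiple of `α n`. -/

theorem exists_functional_completion {X : Type*} [SeminormedAddCommGroup X] [NormedSpace ℂ X]
    (g : X →ₗ[ℂ] ℂ) {C : ℝ} (hC : 0 ≤ C) (h : ∀ x, ‖g x‖ ≤ C * ‖x‖) :
    ∃ G : UniformSpace.Completion X →L[ℂ] ℂ, (∀ x : X, G x = g x) ∧ ‖G‖ ≤ C := by
  let e : X →ₗ[ℂ] UniformSpace.Completion X :=
    (UniformSpace.Completion.toComplL : X →L[ℂ] UniformSpace.Completion X).toLinearMap
  have hd : DenseRange e := UniformSpace.Completion.denseRange_coe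
  have he : ∀ x, ‖g x‖ ≤ C * ‖e x‖ := fun x => by
    have h1 : ‖e x‖ = ‖x‖ := UniformSpace.Completion.norm_coe x
    rw [h1]
    exact h x
  exact ⟨g.extendOfNorm e, fun x => LinearMap.extendOfNorm_eq hd ⟨C, he⟩ x,
    LinearMap.opNorm_extendOfNorm_le hd hC he⟩

/-- The series of rank-one operators converges in operator norm, so its sum is continuous and is
determined by its values on the dense image of `X`. -/
theorem isNuclearMap_of_forall_coe {X Y : Type*} [SeminormedAddCommGroup X] [NormedSpace ℂ X]
    [NormedAddCommGroup Y] [NormedSpace ℂ Y] [CompleteSpace Y]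
    (T : UniformSpace.Completion X →L[ℂ] Y) (f : ℕ → UniformSpace.Completion X →L[ℂ] ℂ)
    (y : ℕ → Y) (hsum : Summable fun i => ‖f i‖ * ‖y i‖)
    (h : ∀ x : X, HasSum (fun i => f i x • y i) (T x)) : IsNuclearMap T := by
  refine ⟨f, y, hsum, ?_⟩
  have hS : Summable fun i => (f i).smulRight (y i) :=
    Summable.of_norm (by simpa only [ContinuousLinearMap.norm_smulRight_apply] using hsum)
  have happ : ∀ z, HasSum (fun i => f i z • y i) ((∑' i, (f i).smulRight (y i)) z) := fun z => by
    simpa using! hS.hasSum.mapL (ContinuousLinearMap.apply ℂ Y z)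
  have hT : ⇑(∑' i, (f i).smulRight (y i)) = T :=
    UniformSpace.Completion.ext (ContinuousLinearMap.continuous _) T.continuous
      fun x => (happ x).unique (h x)
  intro z
  rw [← hT]
  exact happ z

/-! ## The norm of `c_0(v)` -/

theorem C0.weight_mul_norm_le {v : ℕ → ℝ} (hv : ∀ n, 0 ≤ v n) (x : C0 v) (n : ℕ) :
    v n * ‖x.1 n‖ ≤ ‖x‖ := by
  have h : ‖v n • x.1 n‖ ≤ ‖x‖ := le_ciSup (bddAbove_c0 (show c0Sub v from x)) n
  simpa only [norm_smul, Real.norm_eq_abs, abs_of_nonneg (hv n)] using h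

theorem C0.norm_le {v : ℕ → ℝ} (hv : ∀ n, 0 ≤ v n) (x : C0 v) {C : ℝ}
    (h : ∀ n, v n * ‖x.1 n‖ ≤ C) : ‖x‖ ≤ C := by
  refine ciSup_le (f := fun n => ‖v n • x.1 n‖) fun n => ?_
  simpa only [norm_smul, Real.norm_eq_abs, abs_of_nonneg (hv n)] using h n

instance (v : ℕ → ℝ) : NormedSpace ℂ (C0 v) where
  norm_smul_le c x := (map_smul_eq_mul (c0Norm v) c (show c0Sub v from x)).le

/-! ## Seminorms on `E_α` -/

theorem CoSpace.toSeq_injective : Function.Injective (CoSpace.toSeq (α := α) (s := s)) :=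
  Subtype.val_injective

theorem CoSpace.exists_incl_eq (hα : IsExponent α) (hs : IsBase s) (x : CoSpace α s) :
    ∃ (k : ℕ) (y : C0 (weight α s k)), CoSpace.incl α s k y = x := by
  obtain ⟨k, hk⟩ := (mem_coSub hα hs x.1).1 x.2
  exact ⟨k, ⟨x.1, (mem_c0Sub (fun n => (weight_pos hs k n).le) x.1).2 hk⟩, rfl⟩

theorem Continuous.exists_bound_incl {q : Seminorm ℂ (CoSpace α s)} (hq : Continuous q) (k : ℕ) :
    ∃ C, 0 < C ∧ ∀ x, q (CoSpace.incl α s k x) ≤ C * ‖x‖ :=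
  (q.comp (CoSpace.incl α s k)).bound_of_continuous_normedSpace
    (hq.comp (CoSpace.continuous_incl α s k))

/-- The topology of the single seminorm `q` is one of the locally convex topologies over which the
infimum is taken, so the inductive topology is finer. -/
theorem continuous_of_bound_incl (q : Seminorm ℂ (CoSpace α s))
    (h : ∀ k, ∃ C, ∀ x, q (CoSpace.incl α s k x) ≤ C * ‖x‖) : Continuous q := by
  let t : TopologicalSpace (CoSpace α s) :=
    inferInstanceAs (TopologicalSpace (LocalSpace q))
  have hle : instTopologicalSpaceCoSpace α s ≤ t := by
    refine sInf_le (a := t) ⟨fun k => ?_, inferInstanceAs (IsTopologicalAddGroup (LocalSpace q)),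
      inferInstanceAs (ContinuousSMul ℂ (LocalSpace q)),
      inferInstanceAs (LocallyConvexSpace ℝ (LocalSpace q))⟩
    obtain ⟨C, hC⟩ := h k
    let L : C0 (weight α s k) →ₗ[ℂ] LocalSpace q := CoSpace.incl α s k
    exact AddMonoidHomClass.continuous_of_bound L C hC
  have hn : Continuous[t, _] q := continuous_norm (E := LocalSpace q)
  exact continuous_le_dom hle hn

/-- A weight sequence dominated by all the weights `v_k`. -/
def IsDominated (α s w : ℕ → ℝ) : Prop :=
  ∀ k, ∃ C, 0 ≤ C ∧ ∀ n, w n ≤ C * weight α s k n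

theorem IsDominated.mul_norm_le {w : ℕ → ℝ} (hs : IsBase s) {k : ℕ} {C : ℝ} (hC0 : 0 ≤ C)
    (hC : ∀ n, w n ≤ C * weight α s k n) (x : C0 (weight α s k)) (n : ℕ) :
    w n * ‖(CoSpace.incl α s k x).toSeq n‖ ≤ C * ‖x‖ := by
  refine (mul_le_mul_of_nonneg_right (hC n) (norm_nonneg _)).trans ?_
  rw [mul_assoc]
  exact mul_le_mul_of_nonneg_left
    (C0.weight_mul_norm_le (fun n => (weight_pos hs k n).le) x n) hC0

theorem IsDominated.bddAbove {w : ℕ → ℝ} (hα : IsExponent α) (hs : IsBase s)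
    (hw : IsDominated α s w) (x : CoSpace α s) :
    BddAbove (Set.range fun n => w n * ‖x.toSeq n‖) := by
  obtain ⟨k, y, rfl⟩ := CoSpace.exists_incl_eq hα hs x
  obtain ⟨C, hC0, hC⟩ := hw k
  exact ⟨C * ‖y‖, Set.forall_mem_range.2 fun n => IsDominated.mul_norm_le hs hC0 hC y n⟩

/-- The seminorm `x ↦ sup_n w_n |x_n|` on `E_α`. -/
def supSeminorm (hα : IsExponent α) (hs : IsBase s) (w : ℕ → ℝ) (hw0 : ∀ n, 0 ≤ w n)
    (hw : IsDominated α s w) : Seminorm ℂ (CoSpace α s) :=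
  Seminorm.of (fun x => ⨆ n, w n * ‖x.toSeq n‖)
    (fun x y => ciSup_le fun n => by
      rw [map_add, Pi.add_apply]
      refine (mul_le_mul_of_nonneg_left (norm_add_le _ _) (hw0 n)).trans ?_
      rw [mul_add]
      exact add_le_add (le_ciSup (hw.bddAbove hα hs x) n) (le_ciSup (hw.bddAbove hα hs y) n))
    (fun c x => by
      rw [Real.mul_iSup_of_nonneg (norm_nonneg c)]
      refine iSup_congr fun n => ?_
      rw [map_smul, Pi.smul_apply, norm_smul, mul_left_comm])

theorem mul_norm_le_supSeminorm (hα : IsExponent α) (hs : IsBase s) {w : ℕ → ℝ}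
    (hw0 : ∀ n, 0 ≤ w n) (hw : IsDominated α s w) (x : CoSpace α s) (n : ℕ) :
    w n * ‖x.toSeq n‖ ≤ supSeminorm hα hs w hw0 hw x :=
  le_ciSup (hw.bddAbove hα hs x) n

theorem continuous_supSeminorm (hα : IsExponent α) (hs : IsBase s) {w : ℕ → ℝ}
    (hw0 : ∀ n, 0 ≤ w n) (hw : IsDominated α s w) : Continuous (supSeminorm hα hs w hw0 hw) :=
  continuous_of_bound_incl _ fun k => by
    obtain ⟨C, hC0, hC⟩ := hw k
    exact ⟨C, fun x => ciSup_le fun n => IsDominated.mul_norm_le hs hC0 hC x n⟩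

/-! ## Unit vectors -/

/-- A finitely supported sequence as an element of `c_0(v)`. -/
def C0.trunc (v : ℕ → ℝ) (N : ℕ) (c : ℕ → ℂ) : C0 v :=
  ⟨fun n => if n < N then c n else 0, by
    refine tendsto_const_nhds.congr' ?_
    filter_upwards [eventually_ge_atTop N] with n hn
    simp [not_lt.2 hn]⟩

/-- The unit vector `e_n` of `E_α`. -/
def CoSpace.unit (α s : ℕ → ℝ) (n : ℕ) : CoSpace α s :=
  CoSpace.incl α s 0 ⟨Pi.single n 1, by
    refine tendsto_const_nhds.congr' ?_
    filter_upwards [eventually_gt_atTop n] with i hi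
    simp [hi.ne']⟩

theorem CoSpace.toSeq_unit (n : ℕ) : (CoSpace.unit α s n).toSeq = Pi.single n 1 := rfl

theorem CoSpace.incl_trunc (k N : ℕ) (c : ℕ → ℂ) :
    CoSpace.incl α s k (C0.trunc _ N c) = ∑ n ∈ Finset.range N, c n • CoSpace.unit α s n := by
  apply CoSpace.toSeq_injective
  funext i
  have h : (CoSpace.incl α s k (C0.trunc _ N c)).toSeq i = if i < N then c i else 0 := rfl
  rw [h, map_sum, Finset.sum_apply]
  simp [CoSpace.toSeq_unit, Pi.single_apply]

theorem C0.norm_trunc_le {v : ℕ → ℝ} (hv : ∀ n, 0 ≤ v n) (N : ℕ) (c : ℕ → ℂ) {C : ℝ}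
    (hC0 : 0 ≤ C) (h : ∀ n, v n * ‖c n‖ ≤ C) : ‖C0.trunc v N c‖ ≤ C := by
  refine C0.norm_le hv _ fun n => ?_
  have h' : (C0.trunc v N c).1 n = if n < N then c n else 0 := rfl
  rw [h']
  split_ifs
  · exact h n
  · simpa using hC0

theorem C0.tendsto_trunc {v : ℕ → ℝ} (hv : ∀ n, 0 ≤ v n) (x : C0 v) :
    Tendsto (fun N => ‖x - C0.trunc v N x.1‖) atTop (𝓝 0) := by
  have hx := (mem_c0Sub hv x.1).1 x.2
  rw [Metric.tendsto_atTop] at hx ⊢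
  intro ε hε
  obtain ⟨M, hM⟩ := hx (ε / 2) (half_pos hε)
  refine ⟨M, fun N hN => ?_⟩
  rw [Real.dist_0_eq_abs, abs_of_nonneg (norm_nonneg _)]
  refine (C0.norm_le hv _ fun n => ?_).trans_lt (half_lt_self hε)
  have h' : (x - C0.trunc v N x.1).1 n = x.1 n - if n < N then x.1 n else 0 := rfl
  rw [h']
  split_ifs with h
  · simpa using (half_pos hε).le
  · have := hM n (hN.trans (not_lt.1 h))
    rw [Real.dist_0_eq_abs] at this
    rw [sub_zero]
    exact (le_abs_self _).trans this.le

/-- Truncations converge to `x` in the norm of any step `c_0(v_k)` containing `x`, and `p` is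
bounded on that step. -/
theorem CoSpace.tendsto_sum_unit (hα : IsExponent α) (hs : IsBase s)
    {p : Seminorm ℂ (CoSpace α s)} (hp : Continuous p) (x : CoSpace α s) :
    Tendsto (fun N => p (x - ∑ n ∈ Finset.range N, x.toSeq n • CoSpace.unit α s n))
      atTop (𝓝 0) := by
  obtain ⟨k, y, rfl⟩ := CoSpace.exists_incl_eq hα hs x
  obtain ⟨C, -, hC⟩ := Continuous.exists_bound_incl hp k
  have h := (C0.tendsto_trunc (v := weight α s k) (fun n => (weight_pos hs k n).le) y).const_mul C
  rw [mul_zero] at h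
  refine squeeze_zero (fun _ => apply_nonneg _ _) (fun N => ?_) h
  refine le_trans (le_of_eq ?_) (hC (y - C0.trunc _ N y.1))
  rw [map_sub (CoSpace.incl α s k), CoSpace.incl_trunc]
  rfl

/-- Since `e_n` has norm `v_k(n)` in each step, `n ↦ p(e_n)` is a weight dominated by all `v_k`. -/
theorem CoSpace.exists_unit_le (hs : IsBase s) {p : Seminorm ℂ (CoSpace α s)}
    (hp : Continuous p) (k : ℕ) :
    ∃ C, 0 < C ∧ ∀ n, p (CoSpace.unit α s n) ≤ C * weight α s k n := by
  obtain ⟨C, hC0, hC⟩ := Continuous.exists_bound_incl hp k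
  refine ⟨C, hC0, fun n => ?_⟩
  have h1 : CoSpace.incl α s k (C0.trunc _ (n + 1) (Pi.single n 1)) = CoSpace.unit α s n := by
    rw [CoSpace.incl_trunc, Finset.sum_eq_single n] <;> simp +contextual
  rw [← h1]
  refine (hC _).trans (mul_le_mul_of_nonneg_left ?_ hC0.le)
  refine C0.norm_trunc_le (fun n => (weight_pos hs k n).le) _ _ (weight_pos hs k n).le fun i => ?_
  rcases eq_or_ne i n with rfl | h
  · simp
  · simp [h, (weight_pos hs k n).le]

/-! ## Nuclearity -/

theorem weight_eq_exp (hs : IsBase s) (k n : ℕ) :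
    weight α s k n = Real.exp (-(α n * Real.log (s k))) := by
  rw [weight, Real.rpow_def_of_pos (zero_lt_one.trans (hs.one_lt k))]
  congr 1
  ring

theorem exists_pow_mul_weight_le (hα : IsExponent α) (hs : IsBase s)
    (h : BddAbove (Set.range fun n : ℕ => Real.log ((n : ℝ) + 1) / α n)) (j k : ℕ) :
    ∃ l, ∀ n : ℕ, ((n : ℝ) + 1) ^ j * weight α s l n ≤ weight α s k n := by
  obtain ⟨M, hM⟩ := h
  have hlog := Real.tendsto_log_atTop.comp hs.tendsto
  -- As `(n + 1) ^ j ≤ exp (j * M * α n)`, raising `log (s k)` by `j * M` absorbs the polynomial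
  -- factor.
  obtain ⟨l, hl⟩ := (hlog.eventually_ge_atTop (Real.log (s k) + j * M)).exists
  refine ⟨l, fun n => ?_⟩
  have hMn : Real.log ((n : ℝ) + 1) ≤ M * α n :=
    (div_le_iff₀ (hα.pos n)).1 (hM (Set.mem_range_self n))
  have hpos : (0 : ℝ) < (n : ℝ) + 1 := by positivity
  rw [weight_eq_exp hs, weight_eq_exp hs, ← Real.exp_log hpos, ← Real.exp_nat_mul, ← Real.exp_add,
    Real.exp_le_exp]
  have h1 := mul_le_mul_of_nonneg_left hl (hα.pos n).le
  have h2 := mul_le_mul_of_nonneg_left hMn (Nat.cast_nonneg (α := ℝ) j)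
  simp only [Function.comp_apply] at h1
  nlinarith

/-- The coordinate functional `x ↦ x_n`. -/
def CoSpace.coord (α s : ℕ → ℝ) (n : ℕ) : CoSpace α s →ₗ[ℂ] ℂ :=
  (LinearMap.proj n).comp CoSpace.toSeq

theorem isNuclearMap_localId (hα : IsExponent α) (hs : IsBase s) {p q : Seminorm ℂ (CoSpace α s)}
    (hpq : p ≤ q) (hp : Continuous p)
    (hq : ∀ (x : CoSpace α s) (n : ℕ),
      ((n : ℝ) + 1) ^ 2 * p (CoSpace.unit α s n) * ‖x.toSeq n‖ ≤ q x) :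
    IsNuclearMap (localId hpq).completion := by
  have ha : ∀ n, 0 ≤ p (CoSpace.unit α s n) := fun n => apply_nonneg _ _
  have hsq : Summable fun n : ℕ => (((n : ℝ) + 1) ^ 2)⁻¹ := by
    have := (summable_nat_add_iff 1).2 (Real.summable_nat_pow_inv.2 (one_lt_two))
    simpa using this
  let y : ℕ → UniformSpace.Completion (LocalSpace p) := fun n =>
    ((show LocalSpace p from CoSpace.unit α s n) : UniformSpace.Completion (LocalSpace p))
  have hy : ∀ n, ‖y n‖ = p (CoSpace.unit α s n) := fun n => UniformSpace.Completion.norm_coe _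
  -- When `p(e_n) = 0`, `hq` gives no bound on the coordinate; replacing it by `0` costs nothing
  -- because `y n = 0`, and agrees with the convention `0⁻¹ = 0` in `hg`.
  let g : ℕ → LocalSpace q →ₗ[ℂ] ℂ := fun n =>
    if p (CoSpace.unit α s n) = 0 then 0 else CoSpace.coord α s n
  have hg : ∀ n, ∀ x : LocalSpace q,
      ‖g n x‖ ≤ (((n : ℝ) + 1) ^ 2 * p (CoSpace.unit α s n))⁻¹ * ‖x‖ := by
    intro n x
    by_cases h : p (CoSpace.unit α s n) = 0
    · simp [g, h]
    · have hpos : 0 < ((n : ℝ) + 1) ^ 2 * p (CoSpace.unit α s n) :=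
        mul_pos (by positivity) (lt_of_le_of_ne (ha n) (Ne.symm h))
      simp only [g, h]
      rw [le_inv_mul_iff₀ hpos]
      exact hq x n
  have hgy : ∀ n (x : CoSpace α s), g n x • y n
      = ((show LocalSpace p from x.toSeq n • CoSpace.unit α s n) :
        UniformSpace.Completion (LocalSpace p)) := by
    intro n x
    have h1 : ((show LocalSpace p from x.toSeq n • CoSpace.unit α s n) :
        UniformSpace.Completion (LocalSpace p)) = x.toSeq n • y n :=
      UniformSpace.Completion.coe_smul (x.toSeq n) (show LocalSpace p from CoSpace.unit α s n)
    rw [h1]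
    by_cases h : p (CoSpace.unit α s n) = 0
    · rw [show y n = 0 from norm_eq_zero.1 ((hy n).trans h), smul_zero, smul_zero]
    · simp only [g, h]
      rfl
  choose G hG hGn using fun n => exists_functional_completion (g n)
    (inv_nonneg.2 (mul_nonneg (by positivity) (ha n))) (hg n)
  have hbound : ∀ n : ℕ, (((n : ℝ) + 1) ^ 2 * p (CoSpace.unit α s n))⁻¹ * p (CoSpace.unit α s n)
      ≤ (((n : ℝ) + 1) ^ 2)⁻¹ := fun n => by
    rw [mul_inv, mul_assoc]
    exact mul_le_of_le_one_right (by positivity) (inv_mul_le_one)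
  have hsum : Summable fun n => ‖G n‖ * ‖y n‖ := by
    refine Summable.of_nonneg_of_le (fun n => by positivity) (fun n => ?_) hsq
    rw [hy]
    exact (mul_le_mul_of_nonneg_right (hGn n) (ha n)).trans (hbound n)
  refine isNuclearMap_of_forall_coe _ G y hsum fun x => ?_
  have hnorm : Summable fun n => ‖G n x • y n‖ := by
    refine Summable.of_nonneg_of_le (fun n => norm_nonneg _) (fun n => ?_)
      (hsum.mul_right ‖(x : UniformSpace.Completion (LocalSpace q))‖)
    rw [norm_smul, mul_right_comm]
    exact mul_le_mul_of_nonneg_right ((G n).le_opNorm _) (norm_nonneg _)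
  rw [hasSum_iff_tendsto_nat_of_summable_norm hnorm, tendsto_iff_norm_sub_tendsto_zero]
  refine (CoSpace.tendsto_sum_unit hα hs hp x).congr fun N => ?_
  rw [ContinuousLinearMap.completion_apply_coe, norm_sub_rev]
  have h2 : ∑ n ∈ Finset.range N, G n x • y n =
      ((show LocalSpace p from ∑ n ∈ Finset.range N, CoSpace.toSeq x n • CoSpace.unit α s n) :
        UniformSpace.Completion (LocalSpace p)) := by
    have h3 := map_sum (UniformSpace.Completion.toComplL (𝕜 := ℂ) (E := LocalSpace p))
      (fun n => (show LocalSpace p from CoSpace.toSeq x n • CoSpace.unit α s n)) (Finset.range N)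
    refine Eq.trans (Finset.sum_congr rfl fun n _ => ?_) h3.symm
    rw [hG]
    exact hgy n x
  rw [h2, ← UniformSpace.Completion.coe_sub, UniformSpace.Completion.norm_coe]
  rfl

theorem isNuclearSpace_of_bddAbove (hα : IsExponent α) (hs : IsBase s)
    (h : BddAbove (Set.range fun n : ℕ => Real.log ((n : ℝ) + 1) / α n)) :
    IsNuclearSpace (CoSpace α s) := by
  intro p hp
  -- The square makes the nuclear series comparable to `∑ 1 / (n + 1) ^ 2`.
  let w : ℕ → ℝ := fun n => ((n : ℝ) + 1) ^ 2 * p (CoSpace.unit α s n)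
  have hw0 : ∀ n, 0 ≤ w n := fun n => mul_nonneg (by positivity) (apply_nonneg _ _)
  have hw : IsDominated α s w := fun k => by
    obtain ⟨l, hl⟩ := exists_pow_mul_weight_le hα hs h 2 k
    obtain ⟨C, hC0, hC⟩ := CoSpace.exists_unit_le hs hp l
    refine ⟨C, hC0.le, fun n => (mul_le_mul_of_nonneg_left (hC n) (by positivity)).trans ?_⟩
    rw [mul_left_comm]
    exact mul_le_mul_of_nonneg_left (hl n) hC0.le
  have hpq : p ≤ p + supSeminorm hα hs w hw0 hw :=
    fun x => le_add_of_nonneg_right (apply_nonneg _ _)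
  refine ⟨_, hpq, hp.add (continuous_supSeminorm hα hs hw0 hw),
    isNuclearMap_localId hα hs hpq hp fun x n => ?_⟩
  exact (mul_norm_le_supSeminorm hα hs hw0 hw x n).trans
    (le_add_of_nonneg_left (apply_nonneg _ _))

/-! ### Nuclearity forces the growth condition -/

theorem sum_norm_unit_le (hs : IsBase s) (hα : IsExponent α) {q : Seminorm ℂ (CoSpace α s)}
    {D : ℝ} (hD0 : 0 ≤ D) (hD : ∀ x, q (CoSpace.incl α s 0 x) ≤ D * ‖x‖)
    (F : UniformSpace.Completion (LocalSpace q) →L[ℂ] ℂ) (N : ℕ) :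
    ∑ n ∈ Finset.range N, ‖F (show LocalSpace q from CoSpace.unit α s n)‖ ≤ ‖F‖ * D := by
  let z : ℕ → ℂ := fun n => F (show LocalSpace q from CoSpace.unit α s n)
  -- Conjugate phases turn the sum of moduli into one value of `F`, at a vector of norm at most 1 in
  -- `c_0(v_0)` because `v_0 ≤ 1`. If `z n = 0`, then `c n = 0`.
  let c : ℕ → ℂ := fun n => (starRingEnd ℂ) (z n) / ‖z n‖
  have hc : ∀ n, ‖c n‖ ≤ 1 := fun n => by
    simp only [c, norm_div, RCLike.norm_conj, Complex.norm_real, norm_norm]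
    exact div_self_le_one _
  have hcz : ∀ n, c n * z n = ‖z n‖ := fun n => by
    by_cases h : z n = 0
    · simp [h]
    · have h' : (‖z n‖ : ℂ) ≠ 0 := by simpa using h
      simp only [c]
      rw [div_mul_eq_mul_div, Complex.conj_mul', div_eq_iff h', sq]
  have hsum : F (show LocalSpace q from ∑ n ∈ Finset.range N, c n • CoSpace.unit α s n)
      = ((∑ n ∈ Finset.range N, ‖z n‖ : ℝ) : ℂ) := by
    have h3 := map_sum (F.comp (UniformSpace.Completion.toComplL (𝕜 := ℂ) (E := LocalSpace q)))
      (fun n => (show LocalSpace q from c n • CoSpace.unit α s n)) (Finset.range N)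
    refine h3.trans ?_
    push_cast
    refine Finset.sum_congr rfl fun n _ => ?_
    rw [← hcz n]
    exact map_smul (F.comp (UniformSpace.Completion.toComplL (𝕜 := ℂ) (E := LocalSpace q)))
      (c n) (show LocalSpace q from CoSpace.unit α s n)
  have hpos : 0 ≤ ∑ n ∈ Finset.range N, ‖z n‖ := Finset.sum_nonneg fun n _ => norm_nonneg _
  calc ∑ n ∈ Finset.range N, ‖z n‖
      = ‖F (show LocalSpace q from ∑ n ∈ Finset.range N, c n • CoSpace.unit α s n)‖ := by
        rw [hsum, Complex.norm_real, Real.norm_eq_abs, abs_of_nonneg hpos]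
    _ ≤ ‖F‖ * q (∑ n ∈ Finset.range N, c n • CoSpace.unit α s n) := by
        refine (F.le_opNorm _).trans_eq ?_
        rw [UniformSpace.Completion.norm_coe]
        rfl
    _ ≤ ‖F‖ * D := by
        refine mul_le_mul_of_nonneg_left ?_ (norm_nonneg _)
        rw [← CoSpace.incl_trunc 0 N c]
        refine (hD _).trans (mul_le_of_le_one_right hD0 ?_)
        refine C0.norm_trunc_le (fun n => (weight_pos hs 0 n).le) N c zero_le_one fun n => ?_
        refine mul_le_one₀ ?_ (norm_nonneg _) (hc n)
        exact Real.rpow_le_one_of_one_le_of_nonpos (hs.one_lt 0).le (neg_nonpos.2 (hα.pos n).le)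

/-- Taking the `n`-th coordinate of `e_n = ∑ F_i(e_n) y_i` gives `w_n ≤ ∑ |F_i(e_n)| ‖y_i‖`. Summing
over `n` first, `sum_norm_unit_le` bounds the total by `D * ∑ ‖F_i‖ ‖y_i‖`. -/
theorem IsNuclearSpace.exists_sum_le (hα : IsExponent α) (hs : IsBase s)
    (h : IsNuclearSpace (CoSpace α s)) {w : ℕ → ℝ} (hw0 : ∀ n, 0 < w n)
    (hw : IsDominated α s w) : ∃ S, ∀ N, ∑ n ∈ Finset.range N, w n ≤ S := by
  let p := supSeminorm hα hs w (fun n => (hw0 n).le) hw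
  obtain ⟨q, hpq, hq, F, y, hsum, hF⟩ :=
    h p (continuous_supSeminorm hα hs (fun n => (hw0 n).le) hw)
  obtain ⟨D, hD0, hD⟩ := Continuous.exists_bound_incl hq 0
  have hg : ∀ n, ∀ x : LocalSpace p,
      ‖(show LocalSpace p →ₗ[ℂ] ℂ from CoSpace.coord α s n) x‖ ≤ (w n)⁻¹ * ‖x‖ := by
    intro n x
    rw [le_inv_mul_iff₀ (hw0 n)]
    exact mul_norm_le_supSeminorm hα hs (fun n => (hw0 n).le) hw x n
  choose G hG hGn using fun n => exists_functional_completion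
    (show LocalSpace p →ₗ[ℂ] ℂ from CoSpace.coord α s n) (inv_nonneg.2 (hw0 n).le) (hg n)
  have hle : ∀ n, ∃ t, HasSum
      (fun i => ‖F i (show LocalSpace q from CoSpace.unit α s n)‖ * ‖y i‖) t ∧ w n ≤ t := by
    intro n
    let e : LocalSpace q := CoSpace.unit α s n
    have h1 := (hF e).mapL (G n)
    rw [ContinuousLinearMap.completion_apply_coe, hG] at h1
    have h2 : (show LocalSpace p →ₗ[ℂ] ℂ from CoSpace.coord α s n) (localId hpq e) = 1 := by
      change (CoSpace.unit α s n).toSeq n = 1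
      simp [CoSpace.toSeq_unit]
    rw [h2] at h1
    have hs1 : Summable fun i => ‖F i e‖ * ‖y i‖ := by
      refine Summable.of_nonneg_of_le (fun i => by positivity) (fun i => ?_)
        (hsum.mul_right ‖(e : UniformSpace.Completion (LocalSpace q))‖)
      rw [mul_right_comm]
      exact mul_le_mul_of_nonneg_right ((F i).le_opNorm _) (norm_nonneg _)
    refine ⟨_, hs1.hasSum, ?_⟩
    have h3 : ‖(1 : ℂ)‖ ≤ (w n)⁻¹ * ∑' i, ‖F i e‖ * ‖y i‖ := by
      rw [← h1.tsum_eq]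
      refine tsum_of_norm_bounded (hs1.hasSum.mul_left _) fun i => ?_
      rw [map_smul, norm_smul, mul_left_comm]
      exact mul_le_mul_of_nonneg_left (((G n).le_opNorm _).trans
        (mul_le_mul_of_nonneg_right (hGn n) (norm_nonneg _))) (norm_nonneg _)
    rwa [norm_one, le_inv_mul_iff₀ (hw0 n), mul_one] at h3
  choose t ht hwt using hle
  refine ⟨D * ∑' i, ‖F i‖ * ‖y i‖, fun N => (Finset.sum_le_sum fun n _ => hwt n).trans ?_⟩
  refine hasSum_le (fun i => ?_) (hasSum_sum fun n _ => ht n) (hsum.hasSum.mul_left D)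
  rw [← Finset.sum_mul, ← mul_assoc, mul_comm D]
  exact mul_le_mul_of_nonneg_right (sum_norm_unit_le hs hα hD0.le hD (F i) N) (norm_nonneg _)

theorem bddAbove_of_isNuclearSpace (hα : IsExponent α) (hs : IsBase s)
    (h : IsNuclearSpace (CoSpace α s)) :
    BddAbove (Set.range fun n : ℕ => Real.log ((n : ℝ) + 1) / α n) := by
  set r : ℕ → ℝ := fun n => Real.log ((n : ℝ) + 1) / α n with hr
  by_contra hb
  have hub : ∀ B, ∃ n, B < r n := fun B => by
    by_contra! hcon
    exact hb ⟨B, Set.forall_mem_range.2 hcon⟩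
  let R := partialSups r
  have hRmono : Monotone R := R.monotone
  have hRtend : Tendsto R atTop atTop := by
    refine tendsto_atTop_atTop_of_monotone hRmono fun B => ?_
    obtain ⟨n, hn⟩ := hub B
    exact ⟨n, hn.le.trans (le_partialSups r n)⟩
  have hr0 : ∀ n, 0 ≤ r n := fun n =>
    div_nonneg (Real.log_nonneg (by linarith [Nat.cast_nonneg (α := ℝ) n])) (hα.pos n).le
  have hR0 : ∀ n, 0 ≤ R n := fun n => (hr0 n).trans (le_partialSups r n)
  -- `R n / 2` still tends to infinity, so `w` is dominated by every `v_k`; where `R n = r n`, the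
  -- half makes `w n` equal to `(n + 1) ^ (-1/2)`.
  let w : ℕ → ℝ := fun n => Real.exp (-(α n * (R n / 2)))
  have hwanti : Antitone w := fun m n hmn => by
    refine Real.exp_le_exp.2 (neg_le_neg ?_)
    exact mul_le_mul (hα.strictMono.monotone hmn) (by linarith [hRmono hmn])
      (by linarith [hR0 m]) (hα.pos n).le
  have hw : IsDominated α s w := by
    intro k
    obtain ⟨m, hm⟩ := (hRtend.eventually_ge_atTop (2 * Real.log (s k))).exists_forall_of_atTop
    have hlog : 0 ≤ Real.log (s k) := Real.log_nonneg (hs.one_lt k).le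
    -- The constant only serves the indices `n ≤ m`; beyond `m` the exponent `R n / 2` already
    -- exceeds `log (s k)`.
    refine ⟨Real.exp (α m * Real.log (s k)), (Real.exp_pos _).le, fun n => ?_⟩
    rw [weight_eq_exp hs, ← Real.exp_add]
    refine Real.exp_le_exp.2 ?_
    rcases le_total m n with hmn | hmn
    · have h1 := mul_le_mul_of_nonneg_left (hm n hmn) (hα.pos n).le
      have h2 := mul_nonneg (hα.pos m).le hlog
      linarith
    · have h1 := mul_le_mul_of_nonneg_right (hα.strictMono.monotone hmn) hlog
      have h2 := mul_nonneg (hα.pos n).le (hR0 n)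
      linarith
  obtain ⟨S, hS⟩ := h.exists_sum_le hα hs (fun n => Real.exp_pos _) hw
  obtain ⟨M, hM⟩ := exists_nat_gt (S ^ 2)
  -- The running maximum at `n` is attained at some `N`, which lies beyond `M` because `r n` exceeds
  -- all values up to `M`. Monotonicity of `w` will give `√(N + 1) = (N + 1) * w N ≤ S`, against `S
  -- ^ 2 < M < N`.
  obtain ⟨n, hn⟩ := hub (R M)
  obtain ⟨N, hNn, hN⟩ := exists_partialSups_eq r n
  have hMN : M < N := by
    by_contra! hcon
    have h1 := le_partialSups_of_le r hcon
    have h2 := le_partialSups r n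
    have h3 : r n ≤ partialSups r M := by linarith
    exact absurd hn (not_lt.2 h3)
  have hRN : R N = r N :=
    le_antisymm ((hRmono hNn).trans hN.le) (le_partialSups r N)
  have hwN : w N = Real.exp (-(Real.log ((N : ℝ) + 1) / 2)) := by
    have h1 : α N * (R N / 2) = Real.log ((N : ℝ) + 1) / 2 := by
      rw [hRN, hr]
      field_simp [(hα.pos N).ne']
    simp only [w, h1]
  have hsum : ((N : ℝ) + 1) * w N ≤ S := by
    refine le_trans ?_ (hS (N + 1))
    have := Finset.card_nsmul_le_sum (Finset.range (N + 1)) w (w N)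
      fun i hi => hwanti (Nat.lt_succ_iff.1 (Finset.mem_range.1 hi))
    simpa [nsmul_eq_mul] using this
  have hpos : (0 : ℝ) < (N : ℝ) + 1 := by positivity
  have h1 : ((N : ℝ) + 1) * w N = Real.exp (Real.log ((N : ℝ) + 1) / 2) := by
    rw [hwN]
    nth_rewrite 1 [← Real.exp_log hpos]
    rw [← Real.exp_add]
    congr 1
    ring
  have h2 : Real.exp (Real.log ((N : ℝ) + 1) / 2) ^ 2 = (N : ℝ) + 1 := by
    rw [← Real.exp_nat_mul]
    push_cast
    rw [mul_div_cancel₀ _ two_ne_zero, Real.exp_log hpos]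
  rw [h1] at hsum
  have h3 := pow_le_pow_left₀ (Real.exp_pos _).le hsum 2
  rw [h2] at h3
  have h4 : (M : ℝ) < N := Nat.cast_lt.2 hMN
  linarith

/-! ## Eigenvectors of the Cesàro operator -/

theorem mem_pointSpectrum_iff {E : Type*} [AddCommGroup E] [Module ℂ E] [TopologicalSpace E]
    (T : E →L[ℂ] E) (z : ℂ) : z ∈ pointSpectrum T ↔ ∃ x, x ≠ 0 ∧ T x = z • x := by
  have h : (fun x : E => z • x - T x) = ⇑(z • LinearMap.id - T.toLinearMap : E →ₗ[ℂ] E) := rfl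
  change ¬ Function.Injective (fun x : E => z • x - T x) ↔ _
  rw [h, injective_iff_map_eq_zero]
  push Not
  refine exists_congr fun x => ?_
  rw [and_comm]
  refine and_congr_right fun _ => ?_
  change z • x - T x = 0 ↔ _
  rw [sub_eq_zero, eq_comm]

theorem cesaroSeq_eq_smul_iff {x : ℕ → ℂ} {z : ℂ} :
    cesaroSeq x = z • x ↔
      ∀ n, ∑ i ∈ Finset.range (n + 1), x i = z * ((n : ℂ) + 1) * x n := by
  rw [funext_iff]
  refine forall_congr' fun n => ?_
  have h : (n : ℂ) + 1 ≠ 0 := Nat.cast_add_one_ne_zero n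
  change (∑ i ∈ Finset.range (n + 1), x i) / ((n : ℂ) + 1) = z * x n ↔ _
  rw [div_eq_iff h, mul_right_comm]

/-- An eigenvector of the Cesàro operator whose first nonzero entry is the one at `m` has
eigenvalue `1 / (m + 1)`. -/
theorem exists_eigenvalue_eq {x : ℕ → ℂ} (hx : x ≠ 0) {z : ℂ} (h : cesaroSeq x = z • x) :
    ∃ m, x m ≠ 0 ∧ z = 1 / ((m : ℂ) + 1) := by
  classical
  have hex : ∃ n, x n ≠ 0 := Function.ne_iff.1 hx
  refine ⟨Nat.find hex, Nat.find_spec hex, ?_⟩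
  have h1 := cesaroSeq_eq_smul_iff.1 h (Nat.find hex)
  -- At the first nonzero entry the partial sum consists of that entry alone.
  rw [Finset.sum_range_succ, Finset.sum_eq_zero fun i hi => not_not.1
    (Nat.find_min hex (Finset.mem_range.1 hi)), zero_add] at h1
  rw [eq_div_iff (Nat.cast_add_one_ne_zero _)]
  exact (mul_right_cancel₀ (Nat.find_spec hex) ((one_mul _).trans h1)).symm

/-- The hockey-stick identity, followed by `(n + 1) * n.choose m = (n + 1).choose (m + 1) * (m +
1)`. -/
theorem cesaroSeq_choose (m : ℕ) :
    cesaroSeq (fun n => (n.choose m : ℂ)) = (1 / ((m : ℂ) + 1)) • fun n => (n.choose m : ℂ) := by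
  rw [cesaroSeq_eq_smul_iff]
  intro n
  have h : (m : ℂ) + 1 ≠ 0 := Nat.cast_add_one_ne_zero m
  have h1 : ∑ i ∈ Finset.range (n + 1), i.choose m = (n + 1).choose (m + 1) := by
    induction n with
    | zero => cases m <;> simp [Nat.choose_succ_succ]
    | succ n ih => rw [Finset.sum_range_succ, ih, Nat.choose_succ_succ (n + 1) m, add_comm]
  have h2 := congrArg (Nat.cast (R := ℂ)) (Nat.add_one_mul_choose_eq n m)
  have h3 := congrArg (Nat.cast (R := ℂ)) h1
  push_cast at h2 h3
  rw [h3, one_div, mul_assoc, h2, mul_comm, mul_assoc, mul_inv_cancel₀ h, mul_one]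

/-- An eigenvector with eigenvalue `1 / (m + 1)`, `m ≥ 1`, grows at least linearly. -/
theorem le_norm_eigenvector {x : ℕ → ℂ} {m : ℕ} (hm : 1 ≤ m)
    (h : cesaroSeq x = (1 / ((m : ℂ) + 1)) • x) {n : ℕ} (hn : m ≤ n) :
    (n : ℝ) * ‖x m‖ ≤ m * ‖x n‖ := by
  have h' := cesaroSeq_eq_smul_iff.1 h
  induction n, hn using Nat.le_induction with
  | base => exact le_rfl
  | succ n hn ih =>
    have hm0 : (m : ℂ) + 1 ≠ 0 := Nat.cast_add_one_ne_zero m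
    -- Difference of consecutive eigenvalue equations. Since `m ≥ 1`, the left factor is at most
    -- `n`, so `‖x (n + 1)‖ ≥ (n + 1) / n * ‖x n‖`.
    have hrec : (((n + 1 - m : ℕ) : ℝ) : ℂ) * x (n + 1) = (((n + 1 : ℕ) : ℝ) : ℂ) * x n := by
      have h1 := h' (n + 1)
      rw [Finset.sum_range_succ, h' n] at h1
      rw [Nat.cast_sub (hn.trans (Nat.le_succ n))]
      push_cast at h1 ⊢
      field_simp at h1
      linear_combination -h1
    have hnorm := congrArg norm hrec
    rw [norm_mul, norm_mul, Complex.norm_real, Complex.norm_real, Real.norm_of_nonneg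
      (Nat.cast_nonneg _), Real.norm_of_nonneg (Nat.cast_nonneg _)] at hnorm
    have hle : ((n + 1 - m : ℕ) : ℝ) ≤ n := Nat.cast_le.2 (by omega)
    have hn0 : (0 : ℝ) < n := Nat.cast_pos.2 (hm.trans hn)
    have h2 : ((n + 1 : ℕ) : ℝ) * ‖x n‖ ≤ n * ‖x (n + 1)‖ :=
      hnorm ▸ mul_le_mul_of_nonneg_right hle (norm_nonneg _)
    refine le_of_mul_le_mul_left ?_ hn0
    calc (n : ℝ) * (((n + 1 : ℕ) : ℝ) * ‖x m‖) = ((n + 1 : ℕ) : ℝ) * (n * ‖x m‖) := by ring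
      _ ≤ ((n + 1 : ℕ) : ℝ) * (m * ‖x n‖) := mul_le_mul_of_nonneg_left ih (Nat.cast_nonneg _)
      _ = m * (((n + 1 : ℕ) : ℝ) * ‖x n‖) := by ring
      _ ≤ m * (n * ‖x (n + 1)‖) := mul_le_mul_of_nonneg_left h2 (Nat.cast_nonneg _)
      _ = n * (m * ‖x (n + 1)‖) := by ring

theorem exists_eigenvector (hα : IsExponent α) (hs : IsBase s) {z : ℂ}
    (hz : z ∈ pointSpectrum (cesaro hα hs)) :
    ∃ (x : CoSpace α s) (m : ℕ), x.toSeq m ≠ 0 ∧ z = 1 / ((m : ℂ) + 1) ∧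
      cesaroSeq x.toSeq = (1 / ((m : ℂ) + 1)) • x.toSeq := by
  obtain ⟨x, hx0, hx⟩ := (mem_pointSpectrum_iff _ z).1 hz
  have hx1 : cesaroSeq x.toSeq = z • x.toSeq := by
    rw [← toSeq_cesaro hα hs, hx, map_smul]
  obtain ⟨m, hm, rfl⟩ := exists_eigenvalue_eq
    (fun h => hx0 (CoSpace.toSeq_injective (h.trans (map_zero _).symm))) hx1
  exact ⟨x, m, hm, rfl, hx1⟩

theorem pointSpectrum_cesaro_eq (hα : IsExponent α) (hs : IsBase s)
    (h : BddAbove (Set.range fun n : ℕ => Real.log ((n : ℝ) + 1) / α n)) :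
    pointSpectrum (cesaro hα hs) = Set.range (fun n : ℕ => 1 / ((n : ℂ) + 1)) := by
  refine Set.Subset.antisymm (fun z hz => ?_) (Set.range_subset_iff.2 fun m => ?_)
  · obtain ⟨-, m, -, hm, -⟩ := exists_eigenvector hα hs hz
    exact ⟨m, hm.symm⟩
  · obtain ⟨l, hl⟩ := exists_pow_mul_weight_le hα hs h m 0
    have hmem : (fun n : ℕ => (n.choose m : ℂ)) ∈ coSub α s := by
      refine (mem_coSub hα hs _).2 ⟨l, squeeze_zero
        (fun n => mul_nonneg (weight_pos hs l n).le (norm_nonneg _))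
        (g := weight α s 0) (fun n => ?_) ?_⟩
      · refine le_trans ?_ (hl n)
        rw [mul_comm, Complex.norm_natCast]
        refine mul_le_mul_of_nonneg_right ?_ (weight_pos hs l n).le
        have h1 : ((n.choose m : ℕ) : ℝ) ≤ (n : ℝ) ^ m := by
          exact_mod_cast Nat.choose_le_pow n m
        exact h1.trans (pow_le_pow_left₀ (Nat.cast_nonneg n) (by linarith) m)
      · have h1 : weight α s 0 = fun n => Real.exp (-(α n * Real.log (s 0))) :=
          funext fun n => weight_eq_exp hs 0 n
        rw [h1]
        exact Real.tendsto_exp_neg_atTop_nhds_zero.comp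
          (hα.tendsto.atTop_mul_const (Real.log_pos (hs.one_lt 0)))
    refine (mem_pointSpectrum_iff _ _).2 ⟨⟨_, hmem⟩, fun h0 => ?_,
      CoSpace.toSeq_injective (cesaroSeq_choose m)⟩
    have h1 := congrFun (congrArg CoSpace.toSeq h0) m
    have h2 : ((m.choose m : ℕ) : ℂ) = 0 := h1
    simp at h2

theorem bddAbove_of_mem_pointSpectrum (hα : IsExponent α) (hs : IsBase s) {z : ℂ}
    (hz : z ∈ pointSpectrum (cesaro hα hs)) (hz1 : z ≠ 1) :
    BddAbove (Set.range fun n : ℕ => Real.log ((n : ℝ) + 1) / α n) := by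
  obtain ⟨x, m, hxm, rfl, hx⟩ := exists_eigenvector hα hs hz
  have hm : 1 ≤ m := Nat.one_le_iff_ne_zero.2 fun h => hz1 (by simp [h])
  obtain ⟨k, hk⟩ := (mem_coSub hα hs _).1 x.2
  have hd : 0 < ‖x.toSeq m‖ := norm_pos_iff.2 hxm
  -- The `m` cancels the one in `le_norm_eigenvector`; the `2` gives `2 * n ≤ exp (α n * log (s
  -- k))`, leaving room for `n + 1 ≤ 2 * n`.
  obtain ⟨N, hN⟩ := (hk.eventually_le_const
    (div_pos hd (by positivity : (0 : ℝ) < 2 * m))).exists_forall_of_atTop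
  have hbound : ∀ n ≥ max N m, Real.log ((n : ℝ) + 1) / α n ≤ Real.log (s k) := by
    intro n hn
    rw [div_le_iff₀ (hα.pos n), Real.log_le_iff_le_exp (by positivity)]
    have h1 : weight α s k n * ‖x.toSeq n‖ ≤ ‖x.toSeq m‖ / (2 * m) :=
      hN n ((le_max_left _ _).trans hn)
    have h2 := le_norm_eigenvector hm hx ((le_max_right _ _).trans hn)
    have hn1 : (1 : ℝ) ≤ n := Nat.one_le_cast.2 (hm.trans ((le_max_right _ _).trans hn))
    have hm0 : (0 : ℝ) < m := Nat.cast_pos.2 hm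
    rw [weight_eq_exp hs, Real.exp_neg, inv_mul_le_iff₀ (Real.exp_pos _)] at h1
    have h3 : (n : ℝ) * ‖x.toSeq m‖ ≤
        Real.exp (α n * Real.log (s k)) * ‖x.toSeq m‖ / 2 := by
      refine h2.trans ((mul_le_mul_of_nonneg_left h1 hm0.le).trans_eq ?_)
      field_simp
    have h4 : (n : ℝ) ≤ Real.exp (α n * Real.log (s k)) / 2 := by
      refine le_of_mul_le_mul_right (h3.trans_eq ?_) hd
      ring
    rw [mul_comm]
    linarith
  exact Filter.IsBoundedUnder.bddAbove_range
    (isBoundedUnder_of_eventually_le ((eventually_ge_atTop (max N m)).mono hbound))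

end CoEchelon

end

theorem proposition2p3 (α s : ℕ → ℝ) (hα : CoEchelon.IsExponent α) (hs : CoEchelon.IsBase s) :
    List.TFAE [
      CoEchelon.IsNuclearSpace (CoEchelon.CoSpace α s),
      BddAbove (Set.range fun n : ℕ => Real.log ((n : ℝ) + 1) / α n),
      CoEchelon.pointSpectrum (CoEchelon.cesaro hα hs)
        = Set.range (fun n : ℕ => 1 / ((n : ℂ) + 1)),
      (CoEchelon.pointSpectrum (CoEchelon.cesaro hα hs) \ {1}).Nonempty] := by
  tfae_have 1 → 2 := CoEchelon.bddAbove_of_isNuclearSpace hα hs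
  tfae_have 2 → 1 := CoEchelon.isNuclearSpace_of_bddAbove hα hs
  tfae_have 2 → 3 := CoEchelon.pointSpectrum_cesaro_eq hα hs
  tfae_have 3 → 4 := fun h => by
    rw [h]
    -- Index `1` is the eigenvalue `1 / 2`.
    exact ⟨_, ⟨1, rfl⟩, by norm_num⟩
  tfae_have 4 → 2 := fun ⟨_, hz, hz1⟩ => CoEchelon.bddAbove_of_mem_pointSpectrum hα hs hz hz1
  tfae_finish
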